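/- Theorem 4.1 (Robertson). Let $(K,P)$ be an ordered field, with $x\ge y$ meaning $x-y\in P\cup\{0\}$, where $P$ is the set of positive elements, and let $K(i)=K+iK$, $i^2=-1$, be its complexification, with conjugation $\overline{x+iy}=x-iy$ for $x,y\in K$. Let $V$ be a vector space of finite dimension $n$ over $K(i)$ with a basis $e_1,\dots,e_n$. Let $\phi:V\times V\to K(i)$ be a hermitian form, that is, $\phi$ is conjugate-linear in the first variable, linear in the second, and $\overline{\phi(v,w)}=\phi(w,v)$ for all $v,w\in V$. Suppose that $\phi$ is non-negative definite, i.e. $\phi(v,v)\ge 0$ for all $v\in V$ (the value $\phi(v,v)$ always lies in $K$). Write $\phi(e_j,e_k)=a_{jk}+i\,b_{jk}$ with $a_{jk},b_{jk}\in K$, so that the matrix $a=(a_{jk})$ is symmetric and $b=(b_{jk})$ is skew-symmetric. Then: 1. $\det(a)\ge\det(b)$; 2. if $n\ge 1$ and $\phi$ is positive definite, i.e. $\phi(v,v)>0$ for all nonzero $v\in V$, then $\det(a)>\det(b)$; 3. if $\det(a)=0$, then $\det(b)=0$. -/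

import Mathlib

open scoped Matrix

/-- The complexification `K(i) = K + iK` of a field `K`: pairs `re + i im` with `i ^ 2 = -1`.
Its `star` is complex conjugation. -/
abbrev Complexification (K : Type*) [Field K] : Type _ := QuadraticAlgebra K (-1) 0

namespace Complexification

/-- The imaginary unit `i`. -/
def I {K : Type*} [Field K] : Complexification K := ⟨0, 1⟩

theorem I_mul_I {K : Type*} [Field K] : (I : Complexification K) * I = -1 := by
  ext <;> simp [I, QuadraticAlgebra.re_one, QuadraticAlgebra.im_one]

theorem star_eq {K : Type*} [Field K] (z : Complexification K) : star z = ⟨z.re, -z.im⟩ := by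
  ext <;> simp

/-- In an ordered field `-1` is not a square, hence `K(i)` is a field
(Mathlib derives the field structure of `K(i)` from this fact). -/
instance fact_not_square {K : Type*} [Field K] [LinearOrder K] [IsStrictOrderedRing K] :
    Fact (∀ r : K, r ^ 2 ≠ (-1 : K) + 0 * r) :=
  ⟨fun r h => by nlinarith [sq_nonneg r]⟩

/-- An element of `K(i)` is `≥ 0` when it lies in `K` and is `≥ 0` there. -/
def IsNonneg {K : Type*} [Field K] [LinearOrder K] (z : Complexification K) : Prop :=
  z.im = 0 ∧ 0 ≤ z.re

/-- An element of `K(i)` is `> 0` when it lies in `K` and is `> 0` there. -/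
def IsPos {K : Type*} [Field K] [LinearOrder K] (z : Complexification K) : Prop :=
  z.im = 0 ∧ 0 < z.re

end Complexification

/-- Sesquilinear forms on `V`: conjugate-linear in the first and linear in the second variable.
Such a form `φ` is hermitian when `φ.IsSymm`, i.e. `star (φ v w) = φ w v` for all `v`, `w`. -/
abbrev SesqForm (K V : Type*) [Field K] [AddCommGroup V] [Module (Complexification K) V] :=
  V →ₗ⋆[Complexification K] V →ₗ[Complexification K] Complexification K

namespace SesqForm

/-- `φ(v, v) ≥ 0` for all `v`. -/
def NonnegDef {K V : Type*} [Field K] [LinearOrder K] [AddCommGroup V]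
    [Module (Complexification K) V] (φ : SesqForm K V) : Prop :=
  ∀ v : V, (φ v v).IsNonneg

/-- `φ(v, v) > 0` for all nonzero `v`. -/
def PosDef {K V : Type*} [Field K] [LinearOrder K] [AddCommGroup V]
    [Module (Complexification K) V] (φ : SesqForm K V) : Prop :=
  ∀ v : V, v ≠ 0 → (φ v v).IsPos

/-- The matrix `a` in `φ (e j) (e k) = a j k + i b j k`. -/
noncomputable def reMatrix {K V : Type*} [Field K] [AddCommGroup V] [Module (Complexification K) V] {n : ℕ}
    (φ : SesqForm K V) (e : Module.Basis (Fin n) (Complexification K) V) :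
    Matrix (Fin n) (Fin n) K :=
  Matrix.of fun j k => (φ (e j) (e k)).re

/-- The matrix `b` in `φ (e j) (e k) = a j k + i b j k`. -/
noncomputable def imMatrix {K V : Type*} [Field K] [AddCommGroup V] [Module (Complexification K) V] {n : ℕ}
    (φ : SesqForm K V) (e : Module.Basis (Fin n) (Complexification K) V) :
    Matrix (Fin n) (Fin n) K :=
  Matrix.of fun j k => (φ (e j) (e k)).im

theorem apply_basis {K V : Type*} [Field K] [AddCommGroup V] [Module (Complexification K) V]
    {n : ℕ} (φ : SesqForm K V) (e : Module.Basis (Fin n) (Complexification K) V) (j k : Fin n) :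
    φ (e j) (e k) = algebraMap K (Complexification K) (φ.reMatrix e j k)
      + Complexification.I * algebraMap K (Complexification K) (φ.imMatrix e j k) := by
  ext <;> simp [reMatrix, imMatrix, Complexification.I]

theorem reMatrix_isSymm {K V : Type*} [Field K] [AddCommGroup V] [Module (Complexification K) V]
    {n : ℕ} (φ : SesqForm K V) (hφ : φ.IsSymm)
    (e : Module.Basis (Fin n) (Complexification K) V) : (φ.reMatrix e)ᵀ = φ.reMatrix e := by
  ext j k
  have h := congrArg QuadraticAlgebra.re (hφ.eq (e j) (e k))
  simpa [reMatrix, starRingEnd_apply] using h.symm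

theorem imMatrix_skew {K V : Type*} [Field K] [AddCommGroup V] [Module (Complexification K) V]
    {n : ℕ} (φ : SesqForm K V) (hφ : φ.IsSymm)
    (e : Module.Basis (Fin n) (Complexification K) V) : (φ.imMatrix e)ᵀ = -φ.imMatrix e := by
  ext j k
  have h := congrArg QuadraticAlgebra.im (hφ.eq (e j) (e k))
  simpa [imMatrix, starRingEnd_apply] using h.symm

end SesqForm

/-!
Write `φ (e j) (e k) = a j k + i b j k` and evaluate `φ` at `v = ∑ (x j + i y j) e j` with
`x`, `y` over `K`: the real part of `φ v v` is `x ⬝ a x + y ⬝ a y - 2 (x ⬝ b y)`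
(`re_apply_complexCombination`). The theorem is thus about a symmetric `a` and a skew `b` over the
ordered field `K` for which this expression is nonnegative.

If `det a ≠ 0`, then `a` is positive definite, and minimizing over `x`, i.e. taking `x = a⁻¹ b y`,
shows that `a - bᵀ a⁻¹ b` is nonnegative (`add_dotProduct_sub_eq_schur`). One may assume
`det b ≠ 0`, so that `bᵀ a⁻¹ b` is positive definite. The determinant does not decrease when a
nonnegative matrix is added to a positive definite one (`det_le_det_add`), so
`det b ^ 2 / det a = det (bᵀ a⁻¹ b) ≤ det a`, hence `det b ≤ det a`; if `φ` is
positive definite, then so is `a - bᵀ a⁻¹ b`, and the inequalities are strict.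
If `det a = 0`, a vector `x` in the kernel of `a` satisfies `2 t (x ⬝ b y) ≤ y ⬝ a y` for all `t`
and `y`, so `x` is also in the left kernel of `b`.

Since `K` need not have square roots, there is no spectral theorem; monotonicity of the determinant
is instead obtained by diagonalizing the increment by a congruence (`exists_congr_diagonal`) and
adding its diagonal entries one by one.
-/

open Matrix

namespace Matrix

/-! ### Symmetric matrices over a field -/

theorem dotProduct_mulVec_congr {ι κ R : Type*} [Fintype ι] [Fintype κ] [CommSemiring R]
    (A : Matrix ι ι R) (P : Matrix ι κ R) (x y : κ → R) :
    x ⬝ᵥ (Pᵀ * A * P) *ᵥ y = (P *ᵥ x) ⬝ᵥ A *ᵥ (P *ᵥ y) := by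
  rw [← mulVec_mulVec, ← mulVec_mulVec, dotProduct_mulVec, vecMul_transpose]

theorem dotProduct_mulVec_comm_of_isSymm {ι R : Type*} [Fintype ι] [CommSemiring R]
    {A : Matrix ι ι R} (hA : Aᵀ = A) (x y : ι → R) : x ⬝ᵥ A *ᵥ y = y ⬝ᵥ A *ᵥ x := by
  rw [dotProduct_mulVec, dotProduct_comm, ← mulVec_transpose, hA]

theorem dotProduct_mulVec_single_one {ι R : Type*} [Fintype ι] [DecidableEq ι] [CommSemiring R]
    (A : Matrix ι ι R) (i : ι) : Pi.single i 1 ⬝ᵥ A *ᵥ Pi.single i 1 = A i i := by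
  simp

/-- A symmetric matrix is congruent to a diagonal one: the columns of `P` are an orthogonal basis for
its bilinear form. -/
theorem exists_congr_diagonal {K : Type*} [Field K] [Invertible (2 : K)] {n : ℕ}
    {A : Matrix (Fin n) (Fin n) K} (hA : Aᵀ = A) :
    ∃ (P : Matrix (Fin n) (Fin n) K) (d : Fin n → K), P.det ≠ 0 ∧ Pᵀ * A * P = diagonal d := by
  have hsymm : (toLinearMap₂' K A : LinearMap.BilinForm K (Fin n → K)).IsSymm :=
    ⟨fun x y => by
      simpa [toLinearMap₂'_apply'] using dotProduct_mulVec_comm_of_isSymm hA x y⟩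
  obtain ⟨v', hv'⟩ := LinearMap.BilinForm.exists_orthogonal_basis hsymm
  have hn : Module.finrank K (Fin n → K) = n := by simp
  let v := v'.reindex (finCongr hn)
  have hv : ∀ i j, i ≠ j → v i ⬝ᵥ A *ᵥ v j = 0 := by
    intro i j hij
    have := hv' (i := (finCongr hn).symm i) (j := (finCongr hn).symm j) (by simpa using hij)
    simpa [v, Function.onFun, toLinearMap₂'_apply'] using this
  have hcol : ∀ j, (Pi.basisFun K (Fin n)).toMatrix v *ᵥ Pi.single j 1 = v j := by
    intro j
    ext i
    simp [Module.Basis.toMatrix_apply]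
  refine ⟨(Pi.basisFun K (Fin n)).toMatrix v, fun i => v i ⬝ᵥ A *ᵥ v i, ?_, ?_⟩
  · have h := congrArg det ((Pi.basisFun K (Fin n)).toMatrix_mul_toMatrix_flip v)
    rw [det_mul, det_one] at h
    exact left_ne_zero_of_mul_eq_one h
  · ext i j
    have h' : ((Pi.basisFun K (Fin n)).toMatrix v)ᵀ * A * (Pi.basisFun K (Fin n)).toMatrix v
        = of fun i j => v i ⬝ᵥ A *ᵥ v j := by
      ext i j
      have h := dotProduct_mulVec_congr A ((Pi.basisFun K (Fin n)).toMatrix v)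
        (Pi.single i 1) (Pi.single j 1)
      rw [hcol, hcol] at h
      simpa using h
    rw [h', of_apply]
    by_cases hij : i = j
    · subst hij
      simp
    · rw [diagonal_apply_ne _ hij, hv i j hij]

/-- Completing the square: at its minimum `x = a⁻¹ b y` the form becomes the Schur complement. -/
theorem add_dotProduct_sub_eq_schur {K : Type*} [Field K] {n : ℕ} {a b : Matrix (Fin n) (Fin n) K}
    (hu : IsUnit a.det) (y : Fin n → K) :
    (a⁻¹ *ᵥ b *ᵥ y) ⬝ᵥ a *ᵥ (a⁻¹ *ᵥ b *ᵥ y) + y ⬝ᵥ a *ᵥ y - 2 * ((a⁻¹ *ᵥ b *ᵥ y) ⬝ᵥ b *ᵥ y)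
      = y ⬝ᵥ (a - bᵀ * a⁻¹ * b) *ᵥ y := by
  have hxA : a *ᵥ (a⁻¹ *ᵥ b *ᵥ y) = b *ᵥ y := by
    rw [mulVec_mulVec, mul_nonsing_inv _ hu, one_mulVec]
  rw [hxA, sub_mulVec, dotProduct_sub, dotProduct_mulVec_congr,
    dotProduct_comm (b *ᵥ y) (a⁻¹ *ᵥ b *ᵥ y)]
  ring

/-! ### Positive matrices over an ordered field -/

section Ordered

variable {K : Type*} [Field K] [LinearOrder K]

theorem det_ne_zero_of_forall_pos {n : ℕ} {A : Matrix (Fin n) (Fin n) K}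
    (hpos : ∀ x, x ≠ 0 → 0 < x ⬝ᵥ A *ᵥ x) : A.det ≠ 0 := by
  intro h
  obtain ⟨x, hx, hAx⟩ := exists_mulVec_eq_zero_iff.mpr h
  simpa [hAx] using hpos x hx

theorem forall_nonneg_of_forall_pos {n : ℕ} {A : Matrix (Fin n) (Fin n) K}
    (hpos : ∀ x, x ≠ 0 → 0 < x ⬝ᵥ A *ᵥ x) (x : Fin n → K) : 0 ≤ x ⬝ᵥ A *ᵥ x := by
  by_cases hx : x = 0
  · simp [hx]
  · exact (hpos x hx).le

theorem inv_forall_pos {n : ℕ} {A : Matrix (Fin n) (Fin n) K}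
    (hpos : ∀ x, x ≠ 0 → 0 < x ⬝ᵥ A *ᵥ x) (x : Fin n → K) (hx : x ≠ 0) :
    0 < x ⬝ᵥ A⁻¹ *ᵥ x := by
  have hu : IsUnit A.det := (det_ne_zero_of_forall_pos hpos).isUnit
  have hxA : A *ᵥ (A⁻¹ *ᵥ x) = x := by rw [mulVec_mulVec, mul_nonsing_inv _ hu, one_mulVec]
  have := hpos (A⁻¹ *ᵥ x) fun h => hx (by rw [← hxA, h, mulVec_zero])
  rwa [hxA, dotProduct_comm] at this

variable [IsStrictOrderedRing K]

theorem det_nonneg_of_forall_nonneg {n : ℕ} {A : Matrix (Fin n) (Fin n) K} (hA : Aᵀ = A)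
    (hpos : ∀ x, 0 ≤ x ⬝ᵥ A *ᵥ x) : 0 ≤ A.det := by
  let : Invertible (2 : K) := invertibleOfNonzero two_ne_zero
  obtain ⟨P, d, hP, h⟩ := exists_congr_diagonal hA
  have hd : ∀ i, 0 ≤ d i := fun i => by
    have := dotProduct_mulVec_single_one (Pᵀ * A * P) i
    rw [dotProduct_mulVec_congr, h, diagonal_apply_eq] at this
    exact this ▸ hpos _
  have hdet := congrArg det h
  rw [det_mul, det_mul, det_transpose, det_diagonal] at hdet
  have h0 : 0 ≤ A.det * P.det ^ 2 := by
    rw [show A.det * P.det ^ 2 = P.det * A.det * P.det by ring, hdet]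
    exact Finset.prod_nonneg fun i _ => hd i
  exact nonneg_of_mul_nonneg_left h0 (by positivity)

theorem det_pos_of_forall_pos {n : ℕ} {A : Matrix (Fin n) (Fin n) K} (hA : Aᵀ = A)
    (hpos : ∀ x, x ≠ 0 → 0 < x ⬝ᵥ A *ᵥ x) : 0 < A.det :=
  lt_of_le_of_ne (det_nonneg_of_forall_nonneg hA (forall_nonneg_of_forall_pos hpos))
    (det_ne_zero_of_forall_pos hpos).symm

/-- A linear function of `t` bounded above on the whole field is constant. -/
theorem eq_zero_of_forall_mul_le {p q : K} (h : ∀ t : K, t * p ≤ q) : p = 0 := by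
  by_contra hp
  have := h ((q + 1) / p)
  rw [div_mul_cancel₀ _ hp] at this
  linarith

theorem forall_pos_of_forall_nonneg_of_det_ne_zero {n : ℕ} {A : Matrix (Fin n) (Fin n) K}
    (hA : Aᵀ = A) (hpos : ∀ x, 0 ≤ x ⬝ᵥ A *ᵥ x) (hdet : A.det ≠ 0) (x : Fin n → K)
    (hx : x ≠ 0) : 0 < x ⬝ᵥ A *ᵥ x := by
  refine lt_of_le_of_ne (hpos x) fun h0 => hdet ?_
  -- An isotropic vector of a nonnegative form lies in its radical.
  refine exists_mulVec_eq_zero_iff.mp ⟨x, hx, dotProduct_eq_zero _ fun y => ?_⟩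
  have hlin : ∀ t : K, t * (-2 * (y ⬝ᵥ A *ᵥ x)) ≤ y ⬝ᵥ A *ᵥ y := fun t => by
    have := hpos (t • x + y)
    simp only [mulVec_add, mulVec_smul, dotProduct_add, add_dotProduct, smul_dotProduct,
      dotProduct_smul, smul_eq_mul, ← h0, dotProduct_mulVec_comm_of_isSymm hA x y] at this
    linarith
  rw [dotProduct_comm]
  linarith [eq_zero_of_forall_mul_le hlin]

/-- The case of `det_le_det_add` in which the increment is diagonal, supported on `s`. Each
diagonal entry is a rank-one update, which multiplies the determinant of the current matrix `B` by
`1 + (B⁻¹ j j) * d j`. -/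
theorem det_add_diagonal_ge {n : ℕ} {A : Matrix (Fin n) (Fin n) K} (hA : Aᵀ = A)
    (hpos : ∀ x, x ≠ 0 → 0 < x ⬝ᵥ A *ᵥ x) {d : Fin n → K} (hd : ∀ i, 0 ≤ d i)
    (s : Finset (Fin n)) :
    A.det ≤ (A + diagonal fun i => if i ∈ s then d i else 0).det ∧
      ((∃ i ∈ s, 0 < d i) → A.det < (A + diagonal fun i => if i ∈ s then d i else 0).det) := by
  induction s using Finset.induction_on with
  | empty => simp
  | insert j s hj ih =>
    set B := A + diagonal fun i => if i ∈ s then d i else 0 with hB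
    have hBs : Bᵀ = B := by simp [hB, hA]
    have hBpos : ∀ x, x ≠ 0 → 0 < x ⬝ᵥ B *ᵥ x := fun x hx => by
      rw [hB, add_mulVec, dotProduct_add]
      refine add_pos_of_pos_of_nonneg (hpos x hx) (Finset.sum_nonneg fun i _ => ?_)
      rw [mulVec_diagonal]
      split_ifs
      · nlinarith [hd i, mul_nonneg (hd i) (mul_self_nonneg (x i))]
      · simp
    have hdet : 0 < B.det := det_pos_of_forall_pos hBs hBpos
    have hinv : 0 < B⁻¹ j j := by
      have := inv_forall_pos hBpos (Pi.single j 1) (by simp)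
      rwa [dotProduct_mulVec_single_one] at this
    have hstep : (A + diagonal fun i => if i ∈ insert j s then d i else 0)
        = B + replicateCol Unit (Pi.single j (d j)) * replicateRow Unit (Pi.single j (1 : K)) := by
      rw [hB, add_assoc]
      congr 1
      ext k l
      by_cases hkl : k = l
      · subst hkl
        by_cases hk : k = j
        · subst hk
          simp [hj, mul_apply]
        · simp [hk, mul_apply]
      · by_cases hk : k = j
        · subst hk
          simp [hkl, mul_apply, Ne.symm hkl]
        · simp [hk, hkl, mul_apply]
    have hformula : (A + diagonal fun i => if i ∈ insert j s then d i else 0).det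
        = B.det + B.det * (B⁻¹ j j * d j) := by
      rw [hstep, det_add_replicateCol_mul_replicateRow hdet.ne'.isUnit]
      have : replicateRow Unit (Pi.single j (1 : K)) * B⁻¹ * replicateCol Unit (Pi.single j (d j))
          = of fun _ _ => B⁻¹ j j * d j := by
        ext
        simp [mul_apply, Pi.single_apply]
      rw [this, det_unique (n := Unit)]
      simp [mul_add]
    rw [hformula]
    have hnn : 0 ≤ B.det * (B⁻¹ j j * d j) := by have := hd j; positivity
    refine ⟨by linarith [ih.1], ?_⟩
    rintro ⟨i, hi, hdi⟩
    rcases Finset.mem_insert.mp hi with rfl | hi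
    · have : 0 < B.det * (B⁻¹ i i * d i) := by positivity
      linarith [ih.1]
    · linarith [ih.2 ⟨i, hi, hdi⟩]

/-- Monotonicity and strict monotonicity of the determinant on positive definite matrices. A congruence
makes the increment `C` diagonal and multiplies both determinants by the same square. -/
theorem det_le_det_add {n : ℕ} {A C : Matrix (Fin n) (Fin n) K} (hA : Aᵀ = A)
    (hpos : ∀ x, x ≠ 0 → 0 < x ⬝ᵥ A *ᵥ x) (hC : Cᵀ = C) (hCpos : ∀ x, 0 ≤ x ⬝ᵥ C *ᵥ x) :
    A.det ≤ (A + C).det ∧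
      (0 < n → (∀ x, x ≠ 0 → 0 < x ⬝ᵥ C *ᵥ x) → A.det < (A + C).det) := by
  let : Invertible (2 : K) := invertibleOfNonzero two_ne_zero
  obtain ⟨P, d, hP, h⟩ := exists_congr_diagonal hC
  have hinj : ∀ x, x ≠ 0 → P *ᵥ x ≠ 0 := fun x hx h0 =>
    hP (exists_mulVec_eq_zero_iff.mp ⟨x, hx, h0⟩)
  have hdi : ∀ i, (P *ᵥ Pi.single i 1) ⬝ᵥ C *ᵥ (P *ᵥ Pi.single i 1) = d i := fun i => by
    rw [← dotProduct_mulVec_congr, h, dotProduct_mulVec_single_one, diagonal_apply_eq]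
  have key := det_add_diagonal_ge (A := Pᵀ * A * P) (d := d)
    (by simp [transpose_mul, hA, mul_assoc])
    (fun x hx => by rw [dotProduct_mulVec_congr]; exact hpos _ (hinj x hx))
    (fun i => hdi i ▸ hCpos _) Finset.univ
  have hsum : (Pᵀ * A * P + diagonal fun i => if i ∈ Finset.univ then d i else 0)
      = Pᵀ * (A + C) * P := by
    simp [← h, mul_add, add_mul]
  have hdet : ∀ B : Matrix (Fin n) (Fin n) K, (Pᵀ * B * P).det = B.det * P.det ^ 2 := fun B => by
    rw [det_mul, det_mul, det_transpose]
    ring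
  have hP2 : 0 < P.det ^ 2 := by positivity
  rw [hsum, hdet, hdet] at key
  refine ⟨le_of_mul_le_mul_right key.1 hP2, fun hn hCpos' => ?_⟩
  refine lt_of_mul_lt_mul_right (key.2 ⟨⟨0, hn⟩, Finset.mem_univ _, ?_⟩) hP2.le
  exact hdi ⟨0, hn⟩ ▸ hCpos' _ (hinj _ (by simp))

/-! ### Comparison of a symmetric and a skew matrix -/

/-- The left kernel of `b` contains the kernel of `a`, as the hypothesis at `t • x`, with `x` in the
kernel of `a`, bounds a linear function of `t`. -/
theorem det_eq_zero_of_det_eq_zero {n : ℕ} {a b : Matrix (Fin n) (Fin n) K}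
    (h : ∀ x y, 0 ≤ x ⬝ᵥ a *ᵥ x + y ⬝ᵥ a *ᵥ y - 2 * (x ⬝ᵥ b *ᵥ y)) (hdet : a.det = 0) :
    b.det = 0 := by
  obtain ⟨x, hx, hax⟩ := exists_mulVec_eq_zero_iff.mpr hdet
  refine exists_vecMul_eq_zero_iff.mp ⟨x, hx, dotProduct_eq_zero _ fun y => ?_⟩
  have hlin : ∀ t : K, t * (2 * (x ⬝ᵥ b *ᵥ y)) ≤ y ⬝ᵥ a *ᵥ y := fun t => by
    have := h (t • x) y
    simp only [mulVec_smul, hax, smul_dotProduct, smul_eq_mul, smul_zero, dotProduct_zero] at this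
    linarith
  rw [← dotProduct_mulVec]
  linarith [eq_zero_of_forall_mul_le hlin]

theorem det_le_and_lt_of_det_ne_zero {n : ℕ} {a b : Matrix (Fin n) (Fin n) K} (ha : aᵀ = a)
    (h : ∀ x y, 0 ≤ x ⬝ᵥ a *ᵥ x + y ⬝ᵥ a *ᵥ y - 2 * (x ⬝ᵥ b *ᵥ y)) (hdet : a.det ≠ 0) :
    b.det ≤ a.det ∧
      (0 < n → (∀ x y, y ≠ 0 → 0 < x ⬝ᵥ a *ᵥ x + y ⬝ᵥ a *ᵥ y - 2 * (x ⬝ᵥ b *ᵥ y)) →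
        b.det < a.det) := by
  have hapos := forall_pos_of_forall_nonneg_of_det_ne_zero ha
    (fun x => by simpa using h x 0) hdet
  have hadet := det_pos_of_forall_pos ha hapos
  -- For singular `b` the matrix `bᵀ a⁻¹ b` is not definite, but then the claim is `0 < det a`.
  by_cases hb : b.det = 0
  · rw [hb]
    exact ⟨hadet.le, fun _ _ => hadet⟩
  have hM : (bᵀ * a⁻¹ * b)ᵀ = bᵀ * a⁻¹ * b := by
    simp [transpose_mul, transpose_nonsing_inv, ha, mul_assoc]
  have hMpos : ∀ x, x ≠ 0 → 0 < x ⬝ᵥ (bᵀ * a⁻¹ * b) *ᵥ x := fun x hx => by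
    rw [dotProduct_mulVec_congr]
    exact inv_forall_pos hapos _ fun h0 => hb (exists_mulVec_eq_zero_iff.mp ⟨x, hx, h0⟩)
  have key := det_le_det_add hM hMpos (C := a - bᵀ * a⁻¹ * b)
    (by rw [transpose_sub, ha, hM])
    (fun y => add_dotProduct_sub_eq_schur hdet.isUnit y ▸ h _ y)
  have hMdet : (bᵀ * a⁻¹ * b).det * a.det = b.det ^ 2 := by
    rw [det_mul, det_mul, det_transpose, det_nonsing_inv, Ring.inverse_eq_inv']
    field_simp
  rw [add_sub_cancel] at key
  refine ⟨le_of_sq_le_sq ?_ hadet.le, fun hn hpos => lt_of_pow_lt_pow_left₀ 2 hadet.le ?_⟩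
  · nlinarith [mul_le_mul_of_nonneg_right key.1 hadet.le]
  · have := key.2 hn fun y hy => add_dotProduct_sub_eq_schur hdet.isUnit y ▸ hpos _ y hy
    nlinarith [mul_lt_mul_of_pos_right this hadet]

end Ordered

end Matrix

/-! ### Passage from the hermitian form to its matrices -/

namespace SesqForm

theorem re_apply_complexCombination {K V : Type*} [Field K] [AddCommGroup V]
    [Module (Complexification K) V] {n : ℕ} (φ : SesqForm K V) (hφ : φ.IsSymm)
    (e : Module.Basis (Fin n) (Complexification K) V) (x y : Fin n → K) :
    (φ (∑ j, (⟨x j, y j⟩ : Complexification K) • e j)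
      (∑ j, (⟨x j, y j⟩ : Complexification K) • e j)).re
      = x ⬝ᵥ φ.reMatrix e *ᵥ x + y ⬝ᵥ φ.reMatrix e *ᵥ y - 2 * (x ⬝ᵥ φ.imMatrix e *ᵥ y) := by
  have hskew : y ⬝ᵥ φ.imMatrix e *ᵥ x = -(x ⬝ᵥ φ.imMatrix e *ᵥ y) := by
    rw [dotProduct_mulVec, dotProduct_comm, ← mulVec_transpose, imMatrix_skew φ hφ e, neg_mulVec,
      dotProduct_neg]
  have hre : ∀ f : Fin n → Complexification K, (∑ j, f j).re = ∑ j, (f j).re := fun f =>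
    map_sum (QuadraticAlgebra.reₗ (R := K) (a := -1) (b := 0)) f Finset.univ
  have hexp : (φ (∑ j, (⟨x j, y j⟩ : Complexification K) • e j)
      (∑ j, (⟨x j, y j⟩ : Complexification K) • e j)).re
      = x ⬝ᵥ φ.reMatrix e *ᵥ x + y ⬝ᵥ φ.reMatrix e *ᵥ y
        - x ⬝ᵥ φ.imMatrix e *ᵥ y + y ⬝ᵥ φ.imMatrix e *ᵥ x := by
    simp only [map_sum, LinearMap.sum_apply, LinearMap.map_smulₛₗ, LinearMap.smul_apply,
      Finset.smul_sum, hre, dotProduct, mulVec, Finset.mul_sum, ← Finset.sum_add_distrib, ← Finset.sum_sub_distrib]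
    rw [Finset.sum_comm]
    refine Finset.sum_congr rfl fun j _ => Finset.sum_congr rfl fun k _ => ?_
    simp [reMatrix, imMatrix, starRingEnd_apply]
    ring
  rw [hexp, hskew]
  ring

theorem complexCombination_ne_zero {K V : Type*} [Field K] [AddCommGroup V]
    [Module (Complexification K) V] {n : ℕ} (e : Module.Basis (Fin n) (Complexification K) V)
    (x : Fin n → K) {y : Fin n → K} (hy : y ≠ 0) :
    ∑ j, (⟨x j, y j⟩ : Complexification K) • e j ≠ 0 := by
  intro h
  refine hy (funext fun j => ?_)
  exact congrArg QuadraticAlgebra.im (Fintype.linearIndependent_iff.mp e.linearIndependent _ h j)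

end SesqForm

theorem theorem4p1 {K : Type*} [Field K] [LinearOrder K] [IsStrictOrderedRing K]
    {V : Type*} [AddCommGroup V] [Module (Complexification K) V]
    {n : ℕ} (e : Module.Basis (Fin n) (Complexification K) V)
    (φ : SesqForm K V) (hherm : φ.IsSymm) (hnonneg : φ.NonnegDef) :
    (φ.reMatrix e).det ≥ (φ.imMatrix e).det ∧
    (0 < n → φ.PosDef → (φ.reMatrix e).det > (φ.imMatrix e).det) ∧
    ((φ.reMatrix e).det = 0 → (φ.imMatrix e).det = 0) := by
  have ha := φ.reMatrix_isSymm hherm e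
  have h : ∀ x y, 0 ≤ x ⬝ᵥ φ.reMatrix e *ᵥ x + y ⬝ᵥ φ.reMatrix e *ᵥ y
      - 2 * (x ⬝ᵥ φ.imMatrix e *ᵥ y) := fun x y =>
    φ.re_apply_complexCombination hherm e x y ▸ (hnonneg _).2
  have hpos (hφ : φ.PosDef) : ∀ x y, y ≠ 0 → 0 < x ⬝ᵥ φ.reMatrix e *ᵥ x
      + y ⬝ᵥ φ.reMatrix e *ᵥ y - 2 * (x ⬝ᵥ φ.imMatrix e *ᵥ y) := fun x y hy =>
    φ.re_apply_complexCombination hherm e x y ▸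
      (hφ _ (SesqForm.complexCombination_ne_zero e x hy)).2
  refine ⟨?_, fun hn hφ => ?_, det_eq_zero_of_det_eq_zero h⟩
  · by_cases hdet : (φ.reMatrix e).det = 0
    · rw [hdet, det_eq_zero_of_det_eq_zero h hdet]
    · exact (det_le_and_lt_of_det_ne_zero ha h hdet).1
  · have hdet : (φ.reMatrix e).det ≠ 0 := det_ne_zero_of_forall_pos fun y hy => by
      simpa using hpos hφ 0 y hy
    exact (det_le_and_lt_of_det_ne_zero ha h hdet).2 hn (hpos hφ)
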